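/- An entangled game $G=(I,O,V,p)$ consists of finite input and output sets $I,O$, an accepting function $V:O^2\times I^2\to\{0,1\}$ and a probability distribution $p$ on $I^2$. All registers below are finite-dimensional Hilbert spaces. The entangled value of $G$ is $$\omega^*(G)=\sup_{|\phi\rangle,A^x,B^y}\ \sum_{x,y,a,b}p_{xy}V(a,b|x,y)\langle\phi|A^x_a\otimes B^y_b|\phi\rangle ,$$ where the supremum is over all unit vectors $|\phi\rangle\in\mathcal A\otimes\mathcal B$, in all finite dimensions, and all projective measurements $A^x=\{A^x_a\}_{a\in O}$ on $\mathcal A$ and $B^y=\{B^y_b\}_{b\in O}$ on $\mathcal B$. For a family of unit vectors (advice states) $|\phi_{xy}\rangle\in\mathcal A\otimes\mathcal B$ and $\rho=\sum_{xy}p_{xy}|x\rangle\langle x|\otimes|\phi_{xy}\rangle\langle\phi_{xy}|\otimes|y\rangle\langle y|$, let $$\omega^*(G|\rho)=\max_{A^x,B^y}\ \sum_{x,y,a,b}p_{xy}V(a,b|x,y)\langle\phi_{xy}|A^x_a\otimes B^y_b|\phi_{xy}\rangle .$$ Put $p_{\cdot y}=\sum_xp_{xy}$, $p_{x\cdot}=\sum_yp_{xy}$,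 $$|L^A_y\rangle=\frac1{\sqrt{p_{\cdot y}}}\sum_x\sqrt{p_{xy}}\,|x\rangle|\phi_{xy}\rangle,\qquad |L^B_x\rangle=\frac1{\sqrt{p_{x\cdot}}}\sum_y\sqrt{p_{xy}}\,|\phi_{xy}\rangle|y\rangle ,$$ $$\sigma^A=\sum_yp_{\cdot y}|L^A_y\rangle\langle L^A_y|_{XAB}\otimes|y\rangle\langle y|_Y,\qquad \sigma^B=\sum_xp_{x\cdot}|x\rangle\langle x|_X\otimes|L^B_x\rangle\langle L^B_x|_{ABY} .$$ The superposed information cost of the family is $I(Y:XA)_{\sigma^A}+I(X:BY)_{\sigma^B}$, where $I$ is the quantum mutual information in bits (von Neumann entropies with logarithm to base $2$), and $SIC(G)$ is the infimum of this cost over all families of advice states (in all finite dimensions) for which $\omega^*(G|\rho)=1$, with $SIC(G)=+\infty$ if there is no such family. Theorem. For every entangled game $G$ whose input distribution is uniform, $p_{xy}=1/|I|^2$ for all $x,y\in I$, $$SIC(G)\ \ge\ \frac{1-\omega^*(G)}{32\ln 2},\qquad\text{or equivalently}\qquad \omega^*(G)\ \ge\ 1-32\ln 2\cdot SIC(G).$$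 -/

import Mathlib

open scoped Matrix Kronecker

noncomputable section

/-! ### Linear algebra of finite-dimensional quantum systems

A register is indexed by a finite type `α` (its computational basis); vectors are functions
`α → ℂ`, operators are matrices `Matrix α α ℂ`, and the tensor product of two registers is indexed
by the product type. -/

namespace Quantum

/-- `v` is a pure state: `⟨v|v⟩ = 1`. -/
def IsPureState {α : Type*} [Fintype α] (v : α → ℂ) : Prop :=
  star v ⬝ᵥ v = 1

/-- The rank-one operator `|v⟩⟨v|`. -/
def ketbra {α : Type*} (v : α → ℂ) : Matrix α α ℂ :=
  Matrix.vecMulVec v (star v)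

/-- Partial trace over the second register. -/
def traceRight {α β : Type*} [Fintype β] (M : Matrix (α × β) (α × β) ℂ) : Matrix α α ℂ :=
  Matrix.of fun i i' => ∑ j, M (i, j) (i', j)

/-- Partial trace over the first register. -/
def traceLeft {α β : Type*} [Fintype α] (M : Matrix (α × β) (α × β) ℂ) : Matrix β β ℂ :=
  Matrix.of fun j j' => ∑ i, M (i, j) (i, j')

lemma isHermitian_ketbra {α : Type*} (v : α → ℂ) : (ketbra v).IsHermitian := by
  ext i j
  simp [ketbra, Matrix.vecMulVec_apply, mul_comm]

lemma isHermitian_traceRight {α β : Type*} [Fintype β] {M : Matrix (α × β) (α × β) ℂ}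
    (hM : M.IsHermitian) : (traceRight M).IsHermitian := by
  ext i i'
  simp only [traceRight, Matrix.conjTranspose_apply, Matrix.of_apply, star_sum]
  exact Finset.sum_congr rfl fun j _ => hM.apply _ _

lemma isHermitian_traceLeft {α β : Type*} [Fintype α] {M : Matrix (α × β) (α × β) ℂ}
    (hM : M.IsHermitian) : (traceLeft M).IsHermitian := by
  ext j j'
  simp only [traceLeft, Matrix.conjTranspose_apply, Matrix.of_apply, star_sum]
  exact Finset.sum_congr rfl fun i _ => hM.apply _ _

/-- The von Neumann entropy `H(ρ) = -tr(ρ log₂ ρ) = -∑ λᵢ log₂ λᵢ`, in bits. -/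
def entropy {α : Type*} [Fintype α] [DecidableEq α] (ρ : Matrix α α ℂ) (hρ : ρ.IsHermitian) : ℝ :=
  ∑ i, Real.negMulLog (hρ.eigenvalues i) / Real.log 2

/-- The quantum mutual information `I(α : β)_ρ = H(α)_ρ + H(β)_ρ - H(αβ)_ρ`. -/
def mutualInfo {α β : Type*} [Fintype α] [DecidableEq α] [Fintype β] [DecidableEq β]
    (ρ : Matrix (α × β) (α × β) ℂ) (hρ : ρ.IsHermitian) : ℝ :=
  entropy (traceRight ρ) (isHermitian_traceRight hρ)
    + entropy (traceLeft ρ) (isHermitian_traceLeft hρ) - entropy ρ hρ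

/-- A projective measurement with outcomes in `O`: a family of orthogonal projections that sums to
the identity (the projections are then automatically mutually orthogonal). -/
structure IsProjectiveMeasurement {O α : Type*} [Fintype O] [Fintype α] [DecidableEq α]
    (P : O → Matrix α α ℂ) : Prop where
  isStarProjection : ∀ a, IsStarProjection (P a)
  sum_eq_one : ∑ a, P a = 1

/-! ### Superposed states

`p x y` is a probability distribution on pairs of inputs and `φ x y` the advice state in `A ⊗ B`,
where `A`, `B` are indexed by `α`, `β`. The input registers `X` and `Y` are indexed by `I`. -/

section Superposed

variable {I α β : Type*} [Fintype I] [DecidableEq I]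

/-- `|L^A_y⟩ = (p_{·y})^{-1/2} ∑_x √p_{xy} |x⟩|φ_{xy}⟩` in `X ⊗ A ⊗ B`. -/
def ketLA (p : I → I → ℝ) (φ : I → I → α × β → ℂ) (y : I) : I × α × β → ℂ :=
  fun t => ((1 / √(∑ x, p x y) * √(p t.1 y) : ℝ) : ℂ) * φ t.1 y t.2

/-- `|L^B_x⟩ = (p_{x·})^{-1/2} ∑_y √p_{xy} |φ_{xy}⟩|y⟩` in `(A ⊗ B) ⊗ Y`. -/
def ketLB (p : I → I → ℝ) (φ : I → I → α × β → ℂ) (x : I) : (α × β) × I → ℂ :=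
  fun t => ((1 / √(∑ y, p x y) * √(p x t.2) : ℝ) : ℂ) * φ x t.2 t.1

/-- `σ^A = ∑_y p_{·y} |L^A_y⟩⟨L^A_y| ⊗ |y⟩⟨y|` on `(X ⊗ A ⊗ B) ⊗ Y`. -/
def sigmaA (p : I → I → ℝ) (φ : I → I → α × β → ℂ) :
    Matrix ((I × α × β) × I) ((I × α × β) × I) ℂ :=
  ∑ y, (∑ x, p x y) • (ketbra (ketLA p φ y) ⊗ₖ ketbra (Pi.single y (1 : ℂ)))

/-- `σ^B = ∑_x p_{x·} |x⟩⟨x| ⊗ |L^B_x⟩⟨L^B_x|` on `X ⊗ ((A ⊗ B) ⊗ Y)`. -/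
def sigmaB (p : I → I → ℝ) (φ : I → I → α × β → ℂ) :
    Matrix (I × (α × β) × I) (I × (α × β) × I) ℂ :=
  ∑ x, (∑ y, p x y) • (ketbra (Pi.single x (1 : ℂ)) ⊗ₖ ketbra (ketLB p φ x))

lemma isHermitian_kronecker_ketbra {γ δ : Type*} (v : γ → ℂ) (w : δ → ℂ) (r : ℝ) :
    (r • (ketbra v ⊗ₖ ketbra w)).IsHermitian := by
  rw [Matrix.IsHermitian, Matrix.conjTranspose_smul, Matrix.conjTranspose_kronecker,
    (isHermitian_ketbra v).eq, (isHermitian_ketbra w).eq, star_trivial]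

lemma isHermitian_sigmaA (p : I → I → ℝ) (φ : I → I → α × β → ℂ) :
    (sigmaA p φ).IsHermitian := by
  rw [sigmaA, Matrix.IsHermitian, Matrix.conjTranspose_sum]
  exact Finset.sum_congr rfl fun y _ => isHermitian_kronecker_ketbra _ _ _

lemma isHermitian_sigmaB (p : I → I → ℝ) (φ : I → I → α × β → ℂ) :
    (sigmaB p φ).IsHermitian := by
  rw [sigmaB, Matrix.IsHermitian, Matrix.conjTranspose_sum]
  exact Finset.sum_congr rfl fun y _ => isHermitian_kronecker_ketbra _ _ _

/-- The reduced state of `σ^A` on `Y ⊗ (X ⊗ A)`: the registers `X A B Y` are listed in the order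
`Y X A B`, and `B` is traced out. -/
def sigmaAReduced [Fintype β] (p : I → I → ℝ) (φ : I → I → α × β → ℂ) :
    Matrix (I × (I × α)) (I × (I × α)) ℂ :=
  traceRight ((sigmaA p φ).submatrix
    (fun t : (I × (I × α)) × β => ((t.1.2.1, t.1.2.2, t.2), t.1.1))
    (fun t : (I × (I × α)) × β => ((t.1.2.1, t.1.2.2, t.2), t.1.1)))

/-- The reduced state of `σ^B` on `X ⊗ (B ⊗ Y)`: the registers `X A B Y` are listed in the order
`X B Y A`, and `A` is traced out. -/
def sigmaBReduced [Fintype α] (p : I → I → ℝ) (φ : I → I → α × β → ℂ) :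
    Matrix (I × (β × I)) (I × (β × I)) ℂ :=
  traceRight ((sigmaB p φ).submatrix
    (fun t : (I × (β × I)) × α => (t.1.1, (t.2, t.1.2.1), t.1.2.2))
    (fun t : (I × (β × I)) × α => (t.1.1, (t.2, t.1.2.1), t.1.2.2)))

lemma isHermitian_sigmaAReduced [Fintype β] (p : I → I → ℝ) (φ : I → I → α × β → ℂ) :
    (sigmaAReduced p φ).IsHermitian :=
  isHermitian_traceRight ((isHermitian_sigmaA p φ).submatrix _)

lemma isHermitian_sigmaBReduced [Fintype α] (p : I → I → ℝ) (φ : I → I → α × β → ℂ) :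
    (sigmaBReduced p φ).IsHermitian :=
  isHermitian_traceRight ((isHermitian_sigmaB p φ).submatrix _)

/-- The superposed information cost of a family of states with a distribution,
`I(Y : XA)_{σ^A} + I(X : BY)_{σ^B}`. -/
def superposedInfoCost [Fintype α] [DecidableEq α] [Fintype β] [DecidableEq β]
    (p : I → I → ℝ) (φ : I → I → α × β → ℂ) : ℝ :=
  mutualInfo (sigmaAReduced p φ) (isHermitian_sigmaAReduced p φ)
    + mutualInfo (sigmaBReduced p φ) (isHermitian_sigmaBReduced p φ)

end Superposed

end Quantum

/-! ### Entangled games -/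

/-- An entangled game with input set `I` and output set `O`: an accepting function
`V a b x y` (outputs `a, b`, inputs `x, y`) and a probability distribution `p` on `I × I`. -/
structure EntangledGame (I O : Type*) [Fintype I] where
  V : O → O → I → I → Bool
  p : I → I → ℝ
  p_nonneg : ∀ x y, 0 ≤ p x y
  p_sum : ∑ x, ∑ y, p x y = 1

namespace EntangledGame

open Quantum

variable {I O : Type*} [Fintype I] [Fintype O]

/-- The input distribution is uniform on `I × I`. -/
def IsUniform (G : EntangledGame I O) : Prop :=
  ∀ x y, G.p x y = 1 / (Fintype.card I : ℝ) ^ 2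

/-- The probability of winning with measurements `P x`, `Q y` when the state shared on inputs
`x, y` is `φ x y`:  `∑_{x,y,a,b} p_{xy} V(a,b|x,y) ⟨φ_{xy}| P^x_a ⊗ Q^y_b |φ_{xy}⟩`. -/
def winProb {α β : Type*} [Fintype α] [Fintype β] (G : EntangledGame I O)
    (φ : I → I → α × β → ℂ) (P : I → O → Matrix α α ℂ) (Q : I → O → Matrix β β ℂ) : ℝ :=
  ∑ x, ∑ y, ∑ a, ∑ b, G.p x y * (if G.V a b x y then 1 else 0) *
    (star (φ x y) ⬝ᵥ ((P x a ⊗ₖ Q y b) *ᵥ φ x y)).re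

/-- The entangled value `ω*(G)`: supremum over finite-dimensional registers, shared pure states
and projective measurements. -/
def value (G : EntangledGame I O) : ℝ :=
  sSup {r | ∃ (m n : ℕ) (φ : Fin m × Fin n → ℂ) (P : I → O → Matrix (Fin m) (Fin m) ℂ)
    (Q : I → O → Matrix (Fin n) (Fin n) ℂ), IsPureState φ ∧
      (∀ x, IsProjectiveMeasurement (P x)) ∧ (∀ y, IsProjectiveMeasurement (Q y)) ∧
      r = G.winProb (fun _ _ => φ) P Q}

/-- The entangled value `ω*(G|ρ)` when the players share the advice states `φ x y`, that is, for
`ρ = ∑ p_{xy} |x⟩⟨x| ⊗ |φ_{xy}⟩⟨φ_{xy}| ⊗ |y⟩⟨y|`. -/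
def valueGiven {α β : Type*} [Fintype α] [DecidableEq α] [Fintype β] [DecidableEq β]
    (G : EntangledGame I O) (φ : I → I → α × β → ℂ) : ℝ :=
  sSup {r | ∃ (P : I → O → Matrix α α ℂ) (Q : I → O → Matrix β β ℂ),
      (∀ x, IsProjectiveMeasurement (P x)) ∧ (∀ y, IsProjectiveMeasurement (Q y)) ∧
      r = G.winProb φ P Q}

/-- The superposed information cost `SIC(G)`: infimum of the cost over all families of advice
states (on registers of any finite dimensions) with which the game has value `1`. It is an extended
real, `⊤` if no family of advice states lets the players win with certainty. -/
def SIC [DecidableEq I] (G : EntangledGame I O) : EReal :=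
  sInf {c | ∃ (m n : ℕ) (φ : I → I → Fin m × Fin n → ℂ), (∀ x y, IsPureState (φ x y)) ∧
    G.valueGiven φ = 1 ∧ c = (superposedInfoCost G.p φ : EReal)}

end EntangledGame

end

/-! Low superposed cost means that local isometries can make the advice nearly independent of the
inputs, so one fixed state serves almost as well as the whole family.

For uniform inputs put `w = 1/|I|`. The state on `Y` and `XA` is classical-quantum, with quantum
parts ρ_y = M_y M_yᴴ, where M_y is the amplitude matrix of |L^A_y⟩ with `B` as column register. Its
mutual information is the entropy of the average σ minus the average entropy
(`log_two_mul_mutualInfo_eq`). In nats this is the mean relative entropy D(ρ_y‖σ), which is at least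
the mean of ‖√ρ_y − √σ‖² in Hilbert–Schmidt norm (`sum_overlap_sq_sub_sqrt_le`, `exists_sqrt_near`).
So the √ρ_y are close to each other on average.

Polar decomposition carries the purification M_y to the canonical one √ρ_y by a map on `B` that
depends on y alone (`exists_coisometry_mul_eq_sqrt`). Symmetrically, σ^B gives a map on `A` that
depends on x alone. Apply both and call the result θ_xy. A common isometry on one side preserves
distances, so the two estimates hold together: θ_xy moves little when either input is resampled
(`exists_isometries_of_superposedInfoCost`).

The players now share θ_{x₀y₀}. Going from θ_xy through θ_{xy₀} to θ_{x₀y₀} and averaging over x₀,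
y₀ bounds the loss (`one_sub_value_le`). No fidelity or Uhlmann argument is needed, and the constant
obtained is 16 ln 2, half the stated one. -/

noncomputable section

open scoped ComplexOrder

namespace Quantum

/-- The squared Hilbert–Schmidt norm of a matrix. -/
def hsNormSq {m n : Type*} [Fintype m] [Fintype n] (A : Matrix m n ℂ) : ℝ :=
  ∑ i, ∑ j, ‖A i j‖ ^ 2

/-! ### Hilbert–Schmidt norm and its invariance under isometries. -/

section HilbertSchmidt

variable {l m n : Type*} [Fintype l] [Fintype m] [Fintype n]

lemma ofReal_hsNormSq (A : Matrix m n ℂ) : (hsNormSq A : ℂ) = (Aᴴ * A).trace := by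
  simp only [hsNormSq, Matrix.trace, Matrix.diag_apply, Matrix.mul_apply,
    Matrix.conjTranspose_apply, Complex.ofReal_sum]
  rw [Finset.sum_comm]
  refine Finset.sum_congr rfl fun i _ => Finset.sum_congr rfl fun j _ => ?_
  rw [mul_comm, RCLike.star_def, Complex.mul_conj, Complex.normSq_eq_norm_sq]

lemma hsNormSq_transpose (A : Matrix m n ℂ) : hsNormSq Aᵀ = hsNormSq A := by
  simp only [hsNormSq, Matrix.transpose_apply]
  exact Finset.sum_comm

lemma hsNormSq_isometry_mul [DecidableEq m] {J : Matrix l m ℂ} (hJ : Jᴴ * J = 1)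
    (A : Matrix m n ℂ) : hsNormSq (J * A) = hsNormSq A := by
  have : ((hsNormSq (J * A) : ℝ) : ℂ) = hsNormSq A := by
    rw [ofReal_hsNormSq, ofReal_hsNormSq, Matrix.conjTranspose_mul, Matrix.mul_assoc,
      ← Matrix.mul_assoc Jᴴ, hJ, Matrix.one_mul]
  exact_mod_cast this

lemma hsNormSq_mul_coisometry [DecidableEq m] {W : Matrix m n ℂ} (hW : W * Wᴴ = 1)
    (A : Matrix l m ℂ) : hsNormSq (A * W) = hsNormSq A := by
  rw [← hsNormSq_transpose, Matrix.transpose_mul, hsNormSq_isometry_mul, hsNormSq_transpose]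
  have := congrArg Matrix.transpose hW
  rw [Matrix.transpose_mul, Matrix.transpose_one] at this
  exact this

lemma hsNormSq_smul (r : ℂ) (A : Matrix m n ℂ) : hsNormSq (r • A) = ‖r‖ ^ 2 * hsNormSq A := by
  simp [hsNormSq, Finset.mul_sum, mul_pow]

lemma hsNormSq_sub_le (A B C : Matrix m n ℂ) :
    hsNormSq (A - C) ≤ 2 * hsNormSq (A - B) + 2 * hsNormSq (B - C) := by
  simp only [hsNormSq, Finset.mul_sum, ← Finset.sum_add_distrib]
  refine Finset.sum_le_sum fun i _ => Finset.sum_le_sum fun j _ => ?_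
  have h : ‖(A - C) i j‖ ≤ ‖(A - B) i j‖ + ‖(B - C) i j‖ := by
    simpa using norm_sub_le_norm_sub_add_norm_sub (A i j) (B i j) (C i j)
  nlinarith [norm_nonneg ((A - C) i j), sq_nonneg (‖(A - B) i j‖ - ‖(B - C) i j‖)]

lemma hsNormSq_fromCols_zero (A : Matrix m n ℂ) :
    hsNormSq (Matrix.fromCols (0 : Matrix m l ℂ) A) = hsNormSq A := by
  simp [hsNormSq]

end HilbertSchmidt

/-! ### Spectra and the concavity gap of the entropy. -/

section Entropy

variable {n : Type*} [Fintype n] [DecidableEq n]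

/-- Both sides are sums over the roots of the same characteristic polynomial, so the order in which
`eigenvalues` lists the spectrum is irrelevant. This evaluates entropies from any explicit
diagonalization. -/
lemma sum_eigenvalues_eq_of_reindex {m : Type*} [Fintype m] [DecidableEq m]
    {A : Matrix n n ℂ} (hA : A.IsHermitian) (e : n ≃ m) {U : Matrix m m ℂ} (hU : Uᴴ * U = 1)
    {d : m → ℝ} (h : A.submatrix e.symm e.symm = U * Matrix.diagonal (fun i => (d i : ℂ)) * Uᴴ)
    (f : ℝ → ℝ) : ∑ i, f (hA.eigenvalues i) = ∑ i, f (d i) := by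
  have h1 : A.charpoly = ∏ i, (Polynomial.X - Polynomial.C (d i : ℂ)) := by
    rw [← Matrix.charpoly_reindex e A, Matrix.reindex_apply, h, Matrix.charpoly_mul_comm,
      ← Matrix.mul_assoc, hU, Matrix.one_mul, Matrix.charpoly_diagonal]
  have h2 := hA.roots_charpoly_eq_eigenvalues
  rw [h1, Polynomial.roots_prod _ _ (Finset.prod_ne_zero_iff.mpr fun i _ =>
    Polynomial.X_sub_C_ne_zero _)] at h2
  simp only [Polynomial.roots_X_sub_C, Multiset.bind_singleton] at h2
  have h3 := congrArg (fun s => (s.map fun z : ℂ => f z.re).sum) h2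
  simp only [Multiset.map_map, Function.comp_def, Complex.ofReal_re] at h3
  exact h3.symm

/-- A Hermitian matrix is `U D Uᴴ` with its eigenvalues in `D`. -/
lemma exists_unitary_diagonalization {A : Matrix n n ℂ} (hA : A.IsHermitian) :
    ∃ U : Matrix n n ℂ, U * Uᴴ = 1 ∧ Uᴴ * U = 1 ∧
      A = U * Matrix.diagonal (fun i => (hA.eigenvalues i : ℂ)) * Uᴴ := by
  refine ⟨hA.eigenvectorUnitary, Unitary.mul_star_self_of_mem hA.eigenvectorUnitary.2,
    Unitary.star_mul_self_of_mem hA.eigenvectorUnitary.2, ?_⟩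
  conv_lhs => rw [hA.spectral_theorem, Unitary.conjStarAlgAut_apply]
  rfl

end Entropy

/-- The left side equals 2r − 2√(rs), so for r > 0 this is log t ≤ t − 1 at t = √(s/r). It is the
scalar form of "relative entropy dominates squared Hellinger distance"; the terms r − s cancel once
summed over states of equal trace. -/
lemma sq_sub_sqrt_add_sub_le_mul_log_sub {r s : ℝ} (hr : 0 ≤ r) (hs : 0 < s) :
    (√r - √s) ^ 2 + r - s ≤ r * Real.log r - r * Real.log s := by
  rcases hr.eq_or_lt with rfl | hr
  · simp [Real.sq_sqrt hs.le]
  have h1 : Real.log (√s / √r) ≤ √s / √r - 1 :=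
    Real.log_le_sub_one_of_pos (div_pos (Real.sqrt_pos.2 hs) (Real.sqrt_pos.2 hr))
  rw [Real.log_div (Real.sqrt_pos.2 hs).ne' (Real.sqrt_pos.2 hr).ne', Real.log_sqrt hs.le,
    Real.log_sqrt hr.le] at h1
  have h2 := mul_le_mul_of_nonneg_left h1 hr.le
  have h3 : r * (√s / √r) = √r * √s := by
    have := (Real.sqrt_pos.2 hr).ne'
    field_simp
    rw [Real.sq_sqrt hr.le]
  nlinarith [Real.sq_sqrt hr.le, Real.sq_sqrt hs.le]

/-- A lower bound on the concavity gap of the entropy: `r y` is the spectrum of the `y`-th state,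
`s` that of the average state, and `c y i j` the squared overlaps of the eigenvectors. -/
lemma sum_overlap_sq_sub_sqrt_le {I d : Type*} [Fintype I] [Fintype d] {c : I → d → d → ℝ}
    (hc : ∀ y i j, 0 ≤ c y i j) (hrow : ∀ y i, ∑ j, c y i j = 1) (hcol : ∀ y j, ∑ i, c y i j = 1)
    {r : I → d → ℝ} (hr : ∀ y i, 0 ≤ r y i) {s : d → ℝ} {w : ℝ} (hw : 0 < w)
    (hcard : (Fintype.card I : ℝ) * w = 1) (hs : ∀ j, s j = w * ∑ y, ∑ i, c y i j * r y i) :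
    w * ∑ y, ∑ i, ∑ j, c y i j * (√(r y i) - √(s j)) ^ 2 ≤
      ∑ j, Real.negMulLog (s j) - w * ∑ y, ∑ i, Real.negMulLog (r y i) := by
  have hs0 : ∀ j, 0 ≤ s j := fun j => by
    rw [hs]
    exact mul_nonneg hw.le (Finset.sum_nonneg fun y _ => Finset.sum_nonneg fun i _ =>
      mul_nonneg (hc y i j) (hr y i))
  have hpt : ∀ y i j, c y i j * ((√(r y i) - √(s j)) ^ 2 + r y i - s j) ≤
      c y i j * (r y i * Real.log (r y i) - r y i * Real.log (s j)) := by
    intro y i j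
    -- A zero eigenvalue of the average forces every term `c y i j * r y i` in its column to vanish,
    -- so the convention `Real.log 0 = 0` does no harm.
    rcases (hs0 j).eq_or_lt with h0 | h0
    · have h1 : ∑ y, ∑ i, c y i j * r y i = 0 := by
        have := hs j
        rw [← h0] at this
        exact (mul_eq_zero.1 this.symm).resolve_left hw.ne'
      rw [Finset.sum_eq_zero_iff_of_nonneg fun y _ => Finset.sum_nonneg fun i _ =>
        mul_nonneg (hc y i j) (hr y i)] at h1
      have h2 := h1 y (Finset.mem_univ _)
      rw [Finset.sum_eq_zero_iff_of_nonneg fun i _ => mul_nonneg (hc y i j) (hr y i)] at h2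
      rcases mul_eq_zero.1 (h2 i (Finset.mem_univ _)) with h3 | h3
      · simp [h3]
      · simp [h3, ← h0]
    · exact mul_le_mul_of_nonneg_left (sq_sub_sqrt_add_sub_le_mul_log_sub (hr y i) h0) (hc y i j)
  have hsum := mul_le_mul_of_nonneg_left (Finset.sum_le_sum fun y (_ : y ∈ Finset.univ) =>
    Finset.sum_le_sum fun i (_ : i ∈ Finset.univ) =>
      Finset.sum_le_sum fun j (_ : j ∈ Finset.univ) => hpt y i j) hw.le
  have e1 : w * ∑ y, ∑ i, ∑ j, c y i j * r y i = ∑ j, s j := by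
    simp only [hs, ← Finset.mul_sum]
    congr 1
    exact (Finset.sum_congr rfl fun y _ => Finset.sum_comm).trans Finset.sum_comm
  have e2 : w * ∑ y, ∑ i, ∑ j, c y i j * s j = ∑ j, s j := by
    have : ∀ y, ∑ i, ∑ j, c y i j * s j = ∑ j, s j := fun y => by
      rw [Finset.sum_comm]
      simp [← Finset.sum_mul, hcol]
    simp only [this, Finset.sum_const, Finset.card_univ, nsmul_eq_mul]
    rw [← mul_assoc, mul_comm w, hcard, one_mul]
  have e3 : w * ∑ y, ∑ i, ∑ j, c y i j * (r y i * Real.log (r y i)) =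
      - (w * ∑ y, ∑ i, Real.negMulLog (r y i)) := by
    simp only [← Finset.sum_mul, hrow, Real.negMulLog, one_mul, neg_mul, Finset.sum_neg_distrib,
      mul_neg, neg_neg]
  have e4 : w * ∑ y, ∑ i, ∑ j, c y i j * (r y i * Real.log (s j)) =
      - ∑ j, Real.negMulLog (s j) := by
    have : ∀ j, Real.negMulLog (s j) =
        - (w * ∑ y, ∑ i, c y i j * (r y i * Real.log (s j))) := fun j => by
      rw [Real.negMulLog, neg_mul]
      conv_lhs => enter [1, 1]; rw [hs]
      simp only [Finset.mul_sum, Finset.sum_mul, mul_assoc]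
    simp only [this, Finset.sum_neg_distrib, neg_neg, ← Finset.mul_sum]
    congr 1
    exact (Finset.sum_congr rfl fun y _ => Finset.sum_comm).trans Finset.sum_comm
  simp only [mul_add, mul_sub, Finset.sum_add_distrib, Finset.sum_sub_distrib] at hsum
  linarith

/-! ### Square roots of positive matrices and canonical purifications. -/

section SquareRoot

variable {d : Type*} [Fintype d] [DecidableEq d]

/-- Unitary invariance lets the difference be read with rows in the basis `U` and columns in the
basis `V`, where its entries are overlaps times eigenvalue differences. This links the operator
distance to the scalar overlap inequality. -/
lemma hsNormSq_conj_diagonal_sub {U V : Matrix d d ℂ} (hU : U * Uᴴ = 1) (hU' : Uᴴ * U = 1)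
    (hV : V * Vᴴ = 1) (hV' : Vᴴ * V = 1) (a b : d → ℝ) :
    hsNormSq (U * Matrix.diagonal (fun i => (a i : ℂ)) * Uᴴ -
      V * Matrix.diagonal (fun i => (b i : ℂ)) * Vᴴ) =
      ∑ i, ∑ j, ‖(Uᴴ * V) i j‖ ^ 2 * (a i - b j) ^ 2 := by
  rw [← hsNormSq_mul_coisometry hV, ← hsNormSq_isometry_mul (J := Uᴴ) (by simpa using hU)]
  have : Uᴴ * ((U * Matrix.diagonal (fun i => (a i : ℂ)) * Uᴴ -
      V * Matrix.diagonal (fun i => (b i : ℂ)) * Vᴴ) * V) =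
      Matrix.diagonal (fun i => (a i : ℂ)) * (Uᴴ * V) -
        (Uᴴ * V) * Matrix.diagonal (fun i => (b i : ℂ)) := by
    rw [Matrix.sub_mul, Matrix.mul_sub]
    congr 1
    · simp only [Matrix.mul_assoc]
      rw [← Matrix.mul_assoc, hU', Matrix.one_mul]
    · simp only [Matrix.mul_assoc]
      rw [hV', Matrix.mul_one]
  rw [this, hsNormSq]
  refine Finset.sum_congr rfl fun i _ => Finset.sum_congr rfl fun j _ => ?_
  rw [Matrix.sub_apply, Matrix.diagonal_mul, Matrix.mul_diagonal, mul_comm _ (b j : ℂ), ← sub_mul,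
    ← Complex.ofReal_sub, norm_mul, mul_pow, Complex.norm_real, Real.norm_eq_abs, sq_abs, mul_comm]

lemma sum_norm_sq_row {C : Matrix d d ℂ} (hC : C * Cᴴ = 1) (i : d) : ∑ j, ‖C i j‖ ^ 2 = 1 := by
  have h := congrFun (congrFun hC i) i
  simp only [Matrix.mul_apply, Matrix.conjTranspose_apply, RCLike.star_def, Complex.mul_conj,
    Complex.normSq_eq_norm_sq, Matrix.one_apply_eq] at h
  exact_mod_cast h

lemma conjTranspose_conj_diagonal (U : Matrix d d ℂ) (a : d → ℝ) :
    (U * Matrix.diagonal (fun i => (a i : ℂ)) * Uᴴ)ᴴ =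
      U * Matrix.diagonal (fun i => (a i : ℂ)) * Uᴴ := by
  rw [Matrix.conjTranspose_mul, Matrix.conjTranspose_mul, Matrix.conjTranspose_conjTranspose,
    Matrix.diagonal_conjTranspose, Matrix.mul_assoc]
  congr 3
  ext i
  simp

lemma conj_diagonal_mul {U : Matrix d d ℂ} (hU : Uᴴ * U = 1) (a b : d → ℝ) :
    U * Matrix.diagonal (fun i => (a i : ℂ)) * Uᴴ *
      (U * Matrix.diagonal (fun i => (b i : ℂ)) * Uᴴ) =
      U * Matrix.diagonal (fun i => ((a i * b i : ℝ) : ℂ)) * Uᴴ := by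
  simp only [Matrix.mul_assoc]
  rw [← Matrix.mul_assoc Uᴴ, hU, Matrix.one_mul, ← Matrix.mul_assoc (Matrix.diagonal _),
    Matrix.diagonal_mul_diagonal]
  simp

/-- `S` is a Hermitian square root of `ρ` and `R` is its pseudo-inverse. -/
structure IsSqrtWithPinv (ρ S R : Matrix d d ℂ) : Prop where
  conjTranspose_sqrt : Sᴴ = S
  conjTranspose_pinv : Rᴴ = R
  sqrt_mul_sqrt : S * S = ρ
  comm : R * S = S * R
  sqrt_mul_pinv_mul_sqrt : S * R * S = S
  pinv_mul_sqrt_mul_pinv : R * S * R = R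

lemma isSqrtWithPinv_conj_diagonal {U : Matrix d d ℂ} (hU : Uᴴ * U = 1) {r : d → ℝ}
    (hr : ∀ i, 0 ≤ r i) :
    IsSqrtWithPinv (U * Matrix.diagonal (fun i => (r i : ℂ)) * Uᴴ)
      (U * Matrix.diagonal (fun i => (√(r i) : ℂ)) * Uᴴ)
      (U * Matrix.diagonal (fun i => (((√(r i))⁻¹ : ℝ) : ℂ)) * Uᴴ) where
  conjTranspose_sqrt := conjTranspose_conj_diagonal _ _
  conjTranspose_pinv := conjTranspose_conj_diagonal _ _
  sqrt_mul_sqrt := by simp only [conj_diagonal_mul hU, Real.mul_self_sqrt (hr _)]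
  comm := by simp only [conj_diagonal_mul hU, mul_comm]
  sqrt_mul_pinv_mul_sqrt := by simp only [conj_diagonal_mul hU, mul_inv_mul_cancel]
  pinv_mul_sqrt_mul_pinv := by
    simp only [conj_diagonal_mul hU]
    congr 3
    ext i
    -- With `0⁻¹ = 0`, entrywise inversion of the spectrum is exactly the pseudo-inverse.
    by_cases h : √(r i) = 0
    · simp [h]
    · rw [inv_mul_cancel₀ h, one_mul]

/-- The square roots of a family of positive matrices are close to one another if the entropy
of the average exceeds the average entropy by little. -/
lemma exists_sqrt_near {I : Type*} [Fintype I] {ρ : I → Matrix d d ℂ}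
    (hρ : ∀ y, (ρ y).PosSemidef) {w : ℝ} (hw : 0 < w) (hcard : (Fintype.card I : ℝ) * w = 1)
    {σ : Matrix d d ℂ} (hσ : σ.IsHermitian) (h : σ = ∑ y, (w : ℂ) • ρ y) :
    ∃ (S R : I → Matrix d d ℂ) (T : Matrix d d ℂ), (∀ y, IsSqrtWithPinv (ρ y) (S y) (R y)) ∧
      w * ∑ y, hsNormSq (S y - T) ≤ ∑ j, Real.negMulLog (hσ.eigenvalues j) -
        w * ∑ y, ∑ i, Real.negMulLog ((hρ y).1.eigenvalues i) := by
  choose U hU hU' hUρ using fun y => exists_unitary_diagonalization (hρ y).1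
  obtain ⟨V, hV, hV', hVσ⟩ := exists_unitary_diagonalization hσ
  set r : I → d → ℝ := fun y => (hρ y).1.eigenvalues with hr
  set s := hσ.eigenvalues with hs
  have hr0 : ∀ y i, 0 ≤ r y i := fun y i => (hρ y).eigenvalues_nonneg i
  have hC : ∀ y, ((U y)ᴴ * V) * ((U y)ᴴ * V)ᴴ = 1 := fun y => by
    rw [Matrix.conjTranspose_mul, Matrix.conjTranspose_conjTranspose, Matrix.mul_assoc,
      ← Matrix.mul_assoc V, hV, Matrix.one_mul, hU']
  have hC' : ∀ y, ((U y)ᴴ * V)ᴴ * ((U y)ᴴ * V) = 1 := fun y => by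
    rw [Matrix.conjTranspose_mul, Matrix.conjTranspose_conjTranspose, Matrix.mul_assoc,
      ← Matrix.mul_assoc (U y), hU, Matrix.one_mul, hV']
  refine ⟨fun y => U y * Matrix.diagonal (fun i => (√(r y i) : ℂ)) * (U y)ᴴ,
    fun y => U y * Matrix.diagonal (fun i => (((√(r y i))⁻¹ : ℝ) : ℂ)) * (U y)ᴴ,
    V * Matrix.diagonal (fun i => (√(s i) : ℂ)) * Vᴴ, fun y => ?_, ?_⟩
  · have := isSqrtWithPinv_conj_diagonal (hU' y) (hr0 y)
    rwa [← hUρ y] at this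
  · simp only [hsNormSq_conj_diagonal_sub (hU _) (hU' _) hV hV']
    refine sum_overlap_sq_sub_sqrt_le (fun _ _ _ => sq_nonneg _)
      (fun y i => sum_norm_sq_row (hC y) i) (fun y j => ?_) hr0 hw hcard fun j => ?_
    · rw [← sum_norm_sq_row (C := ((U y)ᴴ * V)ᴴ) (by simpa using hC' y) j]
      exact Finset.sum_congr rfl fun i _ => by rw [Matrix.conjTranspose_apply, norm_star]
    -- The eigenvalue s_j is the j-th diagonal entry of the averaged ρ_y in the eigenbasis of σ;
    -- each ρ_y contributes its spectrum weighted by the overlaps.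
    · have h1 : Vᴴ * σ * V = Matrix.diagonal fun i => (s i : ℂ) := by
        conv_lhs => rw [hVσ]
        simp only [Matrix.mul_assoc]
        rw [hV', Matrix.mul_one, ← Matrix.mul_assoc, hV', Matrix.one_mul]
      have h2 : ∀ y, (Vᴴ * ρ y * V) j j = ((∑ i, ‖((U y)ᴴ * V) i j‖ ^ 2 * r y i : ℝ) : ℂ) := by
        intro y
        have : Vᴴ * ρ y * V = ((U y)ᴴ * V)ᴴ * (Matrix.diagonal (fun i => (r y i : ℂ)) *
            ((U y)ᴴ * V)) := by
          conv_lhs => rw [hUρ y]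
          simp only [Matrix.conjTranspose_mul, Matrix.conjTranspose_conjTranspose,
            Matrix.mul_assoc]
          rfl
        rw [this, Matrix.mul_apply, Complex.ofReal_sum]
        refine Finset.sum_congr rfl fun i _ => ?_
        rw [Matrix.diagonal_mul, Matrix.conjTranspose_apply, mul_left_comm, RCLike.star_def,
          Complex.conj_mul', mul_comm]
        push_cast
        rfl
      have h3 : (s j : ℂ) = (Vᴴ * σ * V) j j := by rw [h1, Matrix.diagonal_apply_eq]
      rw [h, ← Finset.smul_sum, Matrix.mul_smul, Matrix.smul_mul, Matrix.mul_sum, Matrix.sum_mul,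
        Matrix.smul_apply, Matrix.sum_apply, Finset.sum_congr rfl fun y _ => h2 y] at h3
      rw [smul_eq_mul] at h3
      exact_mod_cast h3

/-- A purification `M` of `ρ = M Mᴴ` is mapped to the canonical one `S = √ρ` by a co-isometry
acting on the purifying register. -/
lemma exists_coisometry_mul_eq_sqrt {D : Type*} [Fintype D] [DecidableEq D] {M : Matrix d D ℂ}
    {S R : Matrix d d ℂ} (h : IsSqrtWithPinv (M * Mᴴ) S R) :
    ∃ W : Matrix D (D ⊕ d) ℂ, W * Wᴴ = 1 ∧ M * W = Matrix.fromCols 0 S := by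
  obtain ⟨hS, hR, hSS, hc, hSRS, hRSR⟩ := h
  have hM : M * Mᴴ * R * R * M = M := by
    -- The difference is (SR − 1)M, and (SR − 1) annihilates S, hence M Mᴴ = S S. Vanishing of A Aᴴ
    -- then gives A = 0.
    have hz : (M * Mᴴ * R * R * M - M) * (M * Mᴴ * R * R * M - M)ᴴ = 0 := by
      have e : M * Mᴴ * R * R * M - M = (S * R - 1) * M := by
        rw [Matrix.sub_mul, Matrix.one_mul, ← hSS]
        congr 2
        rw [Matrix.mul_assoc S S R, ← hc, ← Matrix.mul_assoc, hSRS, hc]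
      rw [e, Matrix.conjTranspose_mul, Matrix.mul_assoc, ← Matrix.mul_assoc M, ← hSS,
        ← Matrix.mul_assoc, ← Matrix.mul_assoc, Matrix.sub_mul, hSRS, Matrix.one_mul, sub_self,
        Matrix.zero_mul, Matrix.zero_mul]
    exact sub_eq_zero.1 (Matrix.self_mul_conjTranspose_eq_zero.1 hz)
  have hMR : M * Mᴴ * R = S := by rw [← hSS, Matrix.mul_assoc, ← hc, ← Matrix.mul_assoc, hSRS]
  have hP : (Mᴴ * R * R * M) * (Mᴴ * R * R * M) = Mᴴ * R * R * M := by
    calc (Mᴴ * R * R * M) * (Mᴴ * R * R * M)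
        = Mᴴ * R * R * (M * Mᴴ * R * R * M) := by simp only [Matrix.mul_assoc]
      _ = _ := by rw [hM]
  have hPH : (Mᴴ * R * R * M)ᴴ = Mᴴ * R * R * M := by
    simp only [Matrix.conjTranspose_mul, Matrix.conjTranspose_conjTranspose, hR, Matrix.mul_assoc]
  -- Mᴴ R is the partial isometry of the polar decomposition, and Mᴴ R R M is its range projection.
  -- The complementary projection, placed in an extra block that M annihilates, completes it to a
  -- co-isometry without any comparison of dimensions.
  refine ⟨Matrix.fromCols (1 - Mᴴ * R * R * M) (Mᴴ * R), ?_, ?_⟩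
  · rw [Matrix.conjTranspose_fromCols_eq_fromRows_conjTranspose, Matrix.fromCols_mul_fromRows,
      Matrix.conjTranspose_sub, hPH, Matrix.conjTranspose_one, Matrix.conjTranspose_mul, hR,
      Matrix.conjTranspose_conjTranspose, ← Matrix.mul_assoc, Matrix.sub_mul, Matrix.mul_sub,
      Matrix.mul_sub, hP]
    simp
  · rw [Matrix.mul_fromCols, Matrix.mul_sub, Matrix.mul_one, ← Matrix.mul_assoc M Mᴴ R, hMR]
    congr 1
    rw [sub_eq_zero]
    conv_lhs => rw [← hM]
    simp only [Matrix.mul_assoc]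

end SquareRoot

/-! ### Mutual information of uniform classical-quantum states. -/

section ClassicalQuantum

variable {I d : Type*} [Fintype I] [DecidableEq I] [Fintype d] [DecidableEq d]

/-- The mutual information of a classical-quantum state with uniform classical part is the
entropy of the average state minus the average entropy. -/
lemma log_two_mul_mutualInfo_eq {τ : I → Matrix d d ℂ} (hτ : ∀ y, (τ y).IsHermitian)
    (htr : ∀ y, (τ y).trace = 1) {w : ℝ} {ρ : Matrix (I × d) (I × d) ℂ} (hρ : ρ.IsHermitian)
    (h : ∀ y s y' s', ρ (y, s) (y', s') = if y = y' then (w : ℂ) * τ y s s' else 0) :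
    Real.log 2 * mutualInfo ρ hρ =
      ∑ j, Real.negMulLog ((isHermitian_traceLeft hρ).eigenvalues j) -
        w * ∑ y, ∑ i, Real.negMulLog ((hτ y).eigenvalues i) := by
  have hlog : Real.log 2 ≠ 0 := (Real.log_pos one_lt_two).ne'
  choose U hU hU' hUτ using fun y => exists_unitary_diagonalization (hτ y)
  have e1 : ∑ i, Real.negMulLog ((isHermitian_traceRight hρ).eigenvalues i) =
      ∑ _ : I, Real.negMulLog w := by
    refine sum_eigenvalues_eq_of_reindex _ (Equiv.refl I) (U := 1) (by simp) ?_ _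
    ext y y'
    simp only [traceRight, Equiv.refl_symm, Equiv.coe_refl, Matrix.submatrix_id_id, Matrix.of_apply,
      h, Matrix.one_mul, Matrix.conjTranspose_one, Matrix.mul_one, Matrix.diagonal_apply]
    split_ifs with hy
    · rw [← Finset.mul_sum]
      have := htr y
      rw [Matrix.trace] at this
      simp only [Matrix.diag_apply] at this
      rw [this, mul_one]
    · simp
  have e2 : ∑ k, Real.negMulLog (hρ.eigenvalues k) =
      ∑ k : d × I, Real.negMulLog (w * (hτ k.2).eigenvalues k.1) := by
    refine sum_eigenvalues_eq_of_reindex hρ (Equiv.prodComm I d) (U := Matrix.blockDiagonal U)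
      ?_ ?_ _
    · rw [Matrix.blockDiagonal_conjTranspose, ← Matrix.blockDiagonal_mul]
      simp only [hU']
      exact Matrix.blockDiagonal_one
    · have : Matrix.diagonal (fun k : d × I => ((w * (hτ k.2).eigenvalues k.1 : ℝ) : ℂ)) =
          Matrix.blockDiagonal fun y =>
            Matrix.diagonal fun i => ((w * (hτ y).eigenvalues i : ℝ) : ℂ) :=
        (Matrix.blockDiagonal_diagonal fun y i => ((w * (hτ y).eigenvalues i : ℝ) : ℂ)).symm
      rw [this, Matrix.blockDiagonal_conjTranspose, ← Matrix.blockDiagonal_mul,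
        ← Matrix.blockDiagonal_mul]
      have hb : ∀ y, U y * Matrix.diagonal (fun i => ((w * (hτ y).eigenvalues i : ℝ) : ℂ)) *
          (U y)ᴴ = (w : ℂ) • τ y := fun y => by
        conv_rhs => rw [hUτ y]
        rw [← Matrix.smul_mul, ← Matrix.mul_smul, ← Matrix.diagonal_smul]
        congr 3
        ext i
        simp
      simp only [hb]
      ext ⟨s, y⟩ ⟨s', y'⟩
      simp [Matrix.blockDiagonal_apply, h]
  have htr' : ∀ y, ∑ i, (hτ y).eigenvalues i = 1 := fun y => by
    have := (hτ y).trace_eq_sum_eigenvalues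
    rw [htr y] at this
    have h2 := congrArg Complex.re this
    simpa using h2.symm
  -- Chain rule: the joint entropy is that of the classical register plus the average conditional
  -- entropy. The classical term cancels against `e1`.
  have e3 : ∑ k : d × I, Real.negMulLog (w * (hτ k.2).eigenvalues k.1) =
      ∑ _ : I, Real.negMulLog w + w * ∑ y, ∑ i, Real.negMulLog ((hτ y).eigenvalues i) := by
    rw [Fintype.sum_prod_type_right, Finset.mul_sum, ← Finset.sum_add_distrib]
    refine Finset.sum_congr rfl fun y _ => ?_
    simp only [Real.negMulLog_mul, Finset.sum_add_distrib, ← Finset.sum_mul, htr', one_mul,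
      ← Finset.mul_sum]
  rw [mutualInfo, entropy, entropy, entropy, ← Finset.sum_div, ← Finset.sum_div, ← Finset.sum_div,
    e1, e2, e3]
  field_simp
  ring

/-- If the mutual information of a classical-quantum state is small, then the purifications `M y`
of the quantum parts are nearly equal up to co-isometries on the purifying register. -/
lemma exists_coisometry_of_mutualInfo {D : Type*} [Fintype D] [DecidableEq D]
    {M : I → Matrix d D ℂ} (htr : ∀ y, (M y * (M y)ᴴ).trace = 1) {w : ℝ} (hw : 0 < w)
    (hcard : (Fintype.card I : ℝ) * w = 1) {ρ : Matrix (I × d) (I × d) ℂ} (hρ : ρ.IsHermitian)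
    (h : ∀ y s y' s', ρ (y, s) (y', s') =
      if y = y' then (w : ℂ) * (M y * (M y)ᴴ) s s' else 0) :
    ∃ W : I → Matrix D (D ⊕ d) ℂ, (∀ y, W y * (W y)ᴴ = 1) ∧
      w ^ 2 * ∑ y, ∑ y', hsNormSq (M y * W y - M y' * W y') ≤
        4 * (Real.log 2 * mutualInfo ρ hρ) := by
  have hpos : ∀ y, (M y * (M y)ᴴ).PosSemidef := fun y => Matrix.posSemidef_self_mul_conjTranspose _
  have hσ : traceLeft ρ = ∑ y, (w : ℂ) • (M y * (M y)ᴴ) := by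
    ext s s'
    simp [traceLeft, h, Matrix.sum_apply]
  obtain ⟨S, R, T, hS, hT⟩ := exists_sqrt_near hpos hw hcard (isHermitian_traceLeft hρ) hσ
  choose W hW hMW using fun y => exists_coisometry_mul_eq_sqrt (hS y)
  refine ⟨W, hW, ?_⟩
  rw [log_two_mul_mutualInfo_eq (fun y => (hpos y).1) htr hρ h]
  have hle : ∀ y y', hsNormSq (M y * W y - M y' * W y') ≤
      2 * hsNormSq (S y - T) + 2 * hsNormSq (S y' - T) := fun y y' => by
    have : M y * W y - M y' * W y' = Matrix.fromCols (0 : Matrix d D ℂ) (S y - S y') := by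
      rw [hMW, hMW]
      ext i (j | j) <;> simp
    rw [this, hsNormSq_fromCols_zero]
    refine (hsNormSq_sub_le _ T _).trans_eq ?_
    rw [show T - S y' = (-1 : ℂ) • (S y' - T) by simp, hsNormSq_smul]
    simp
  have hsum := Finset.sum_le_sum fun y (_ : y ∈ Finset.univ) =>
    Finset.sum_le_sum fun y' (_ : y' ∈ Finset.univ) => hle y y'
  simp only [Finset.sum_add_distrib, Finset.sum_const, Finset.card_univ, nsmul_eq_mul,
    ← Finset.mul_sum] at hsum
  have h2 := mul_le_mul_of_nonneg_left hsum (sq_nonneg w)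
  refine h2.trans ?_
  have : w ^ 2 * ((Fintype.card I : ℝ) * (2 * ∑ y, hsNormSq (S y - T)) +
      (Fintype.card I : ℝ) * (2 * ∑ y, hsNormSq (S y - T))) =
      4 * (w * ∑ y, hsNormSq (S y - T)) := by
    linear_combination (4 * w * ∑ y, hsNormSq (S y - T)) * hcard
  rw [this]
  exact mul_le_mul_of_nonneg_left hT (by norm_num)

end ClassicalQuantum

/-! ### Pure states, coefficient matrices and perturbation of effects. -/

section PureState

variable {α β : Type*} [Fintype α] [Fintype β]

lemma star_dotProduct_self_eq (v : α → ℂ) : star v ⬝ᵥ v = ((∑ i, ‖v i‖ ^ 2 : ℝ) : ℂ) := by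
  rw [dotProduct, Complex.ofReal_sum]
  refine Finset.sum_congr rfl fun i _ => ?_
  rw [Pi.star_apply, RCLike.star_def, Complex.conj_mul', Complex.ofReal_pow]

lemma IsPureState.sum_norm_sq {v : α → ℂ} (hv : IsPureState v) : ∑ i, ‖v i‖ ^ 2 = 1 := by
  rw [IsPureState, star_dotProduct_self_eq] at hv
  exact_mod_cast hv

lemma IsPureState.nonempty {v : α → ℂ} (hv : IsPureState v) : Nonempty α := by
  by_contra h
  rw [not_nonempty_iff] at h
  simpa using hv.sum_norm_sq

lemma star_mulVec_dotProduct (A : Matrix β α ℂ) (E : Matrix β β ℂ) (v : α → ℂ) :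
    star (A *ᵥ v) ⬝ᵥ (E *ᵥ (A *ᵥ v)) = star v ⬝ᵥ ((Aᴴ * E * A) *ᵥ v) := by
  rw [Matrix.star_mulVec, ← Matrix.dotProduct_mulVec, Matrix.mulVec_mulVec, Matrix.mulVec_mulVec,
    Matrix.mul_assoc]

lemma IsPureState.isometry_mulVec [DecidableEq α] [DecidableEq β] {v : α → ℂ}
    (hv : IsPureState v) {A : Matrix β α ℂ} (hA : Aᴴ * A = 1) : IsPureState (A *ᵥ v) := by
  have := star_mulVec_dotProduct A 1 v
  rw [Matrix.mul_one, hA, Matrix.one_mulVec, Matrix.one_mulVec] at this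
  exact this.trans hv

/-- The coefficient matrix of a bipartite vector. -/
def coeffMatrix (v : α × β → ℂ) : Matrix α β ℂ := Matrix.of fun a b => v (a, b)

lemma coeffMatrix_kronecker_mulVec {γ δ : Type*} (J : Matrix γ α ℂ) (K : Matrix δ β ℂ)
    (v : α × β → ℂ) : coeffMatrix ((J ⊗ₖ K) *ᵥ v) = J * coeffMatrix v * Kᵀ := by
  ext c e
  simp only [coeffMatrix, Matrix.of_apply, Matrix.mulVec, dotProduct, Matrix.kronecker_apply,
    Matrix.mul_apply, Matrix.transpose_apply, Finset.sum_mul, Fintype.sum_prod_type]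
  rw [Finset.sum_comm]
  exact Finset.sum_congr rfl fun b _ => Finset.sum_congr rfl fun a _ => by ring

lemma hsNormSq_coeffMatrix_sub (v u : α × β → ℂ) :
    hsNormSq (coeffMatrix v - coeffMatrix u) = ∑ i, ‖(v - u) i‖ ^ 2 := by
  simp [hsNormSq, coeffMatrix, Fintype.sum_prod_type]

lemma IsPureState.hsNormSq_coeffMatrix {v : α × β → ℂ} (hv : IsPureState v) :
    hsNormSq (coeffMatrix v) = 1 := by
  rw [← hv.sum_norm_sq]
  simp [hsNormSq, coeffMatrix, Fintype.sum_prod_type]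

/-- An effect that is nearly certain on `φ` is nearly certain on vectors close to `φ`. -/
lemma re_dotProduct_mulVec_le [DecidableEq α] {F : Matrix α α ℂ} (hF : F.PosSemidef)
    (hF1 : (1 - F).PosSemidef) (ψ φ : α → ℂ) :
    (star ψ ⬝ᵥ (F *ᵥ ψ)).re ≤ 2 * (star φ ⬝ᵥ (F *ᵥ φ)).re + 2 * ∑ i, ‖(ψ - φ) i‖ ^ 2 := by
  have h1 : (star (ψ - φ) ⬝ᵥ (F *ᵥ (ψ - φ))).re ≤ ∑ i, ‖(ψ - φ) i‖ ^ 2 := by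
    have h := (Complex.le_def.1 (hF1.dotProduct_mulVec_nonneg (ψ - φ))).1
    rw [Matrix.sub_mulVec, Matrix.one_mulVec, dotProduct_sub, star_dotProduct_self_eq,
      Complex.sub_re, Complex.ofReal_re] at h
    simpa using h
  -- Parallelogram law for the form of F at φ and ψ − φ: their sum is ψ and, up to sign, their
  -- difference is ψ − 2φ, whose nonnegative term is dropped.
  have h2 := (Complex.le_def.1 (hF.dotProduct_mulVec_nonneg (ψ - φ - φ))).1
  have h3 : star ψ ⬝ᵥ (F *ᵥ ψ) + star (ψ - φ - φ) ⬝ᵥ (F *ᵥ (ψ - φ - φ)) =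
      2 * (star φ ⬝ᵥ (F *ᵥ φ)) + 2 * (star (ψ - φ) ⬝ᵥ (F *ᵥ (ψ - φ))) := by
    simp only [star_sub, Matrix.mulVec_sub, dotProduct_sub, sub_dotProduct]
    ring
  have h4 := congrArg Complex.re h3
  simp only [Complex.add_re, Complex.mul_re, Complex.re_ofNat, Complex.im_ofNat, zero_mul,
    sub_zero, Complex.zero_re] at h4 h2
  linarith

end PureState

/-! ### Transport of projective measurements. -/

section Measurement

variable {O α β : Type*} [Fintype O] [Fintype α] [DecidableEq α] [Fintype β] [DecidableEq β]

lemma posSemidef_of_isStarProjection {ι : Type*} [Fintype ι] {A : Matrix ι ι ℂ} (h : IsStarProjection A) :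
    A.PosSemidef := by
  have h2 : Aᴴ * A = A := by
    rw [← Matrix.star_eq_conjTranspose, h.isSelfAdjoint.star_eq]
    exact h.isIdempotentElem
  exact h2 ▸ Matrix.posSemidef_conjTranspose_mul_self A

lemma IsProjectiveMeasurement.reindex {P : O → Matrix α α ℂ} (hP : IsProjectiveMeasurement P)
    (e : β ≃ α) : IsProjectiveMeasurement fun a => (P a).submatrix e e where
  isStarProjection a := by
    constructor
    · change _ * _ = _
      rw [Matrix.submatrix_mul_equiv, (hP.isStarProjection a).isIdempotentElem]
    · change star _ = _
      rw [Matrix.star_eq_conjTranspose, Matrix.conjTranspose_submatrix,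
        ← Matrix.star_eq_conjTranspose, (hP.isStarProjection a).isSelfAdjoint.star_eq]
  sum_eq_one := by
    ext i j
    have := congrFun (congrFun hP.sum_eq_one (e i)) (e j)
    simpa [Matrix.sum_apply, Matrix.one_apply] using this

/-- Transport of a measurement along an isometry; the outcome `o` also absorbs the complement of
the range. -/
def isometryMeasurement [DecidableEq O] (o : O) (J : Matrix β α ℂ) (P : O → Matrix α α ℂ) (a : O) :
    Matrix β β ℂ :=
  J * P a * Jᴴ + if a = o then 1 - J * Jᴴ else 0

lemma IsProjectiveMeasurement.isometry [DecidableEq O] {P : O → Matrix α α ℂ}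
    (hP : IsProjectiveMeasurement P) (o : O) {J : Matrix β α ℂ} (hJ : Jᴴ * J = 1) :
    IsProjectiveMeasurement (isometryMeasurement o J P) where
  isStarProjection a := by
    have hi : P a * P a = P a := (hP.isStarProjection a).isIdempotentElem
    have hs : (P a)ᴴ = P a := (hP.isStarProjection a).isSelfAdjoint
    have h1 : J * P a * Jᴴ * (J * P a * Jᴴ) = J * P a * Jᴴ := by
      calc J * P a * Jᴴ * (J * P a * Jᴴ) = J * P a * (Jᴴ * J) * P a * Jᴴ := by
            simp only [Matrix.mul_assoc]
        _ = _ := by rw [hJ, Matrix.mul_one, Matrix.mul_assoc J, hi]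
    have h2 : J * P a * Jᴴ * (J * Jᴴ) = J * P a * Jᴴ := by
      rw [← Matrix.mul_assoc, Matrix.mul_assoc _ Jᴴ J, hJ, Matrix.mul_one]
    have h3 : J * Jᴴ * (J * P a * Jᴴ) = J * P a * Jᴴ := by
      rw [Matrix.mul_assoc J (P a), ← Matrix.mul_assoc, Matrix.mul_assoc J Jᴴ J, hJ, Matrix.mul_one]
    have h4 : J * Jᴴ * (J * Jᴴ) = J * Jᴴ := by
      rw [← Matrix.mul_assoc, Matrix.mul_assoc J Jᴴ J, hJ, Matrix.mul_one]
    constructor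
    · change _ * _ = _
      rw [isometryMeasurement]
      split_ifs
      · simp only [Matrix.add_mul, Matrix.mul_add, Matrix.sub_mul, Matrix.mul_sub, Matrix.one_mul,
          Matrix.mul_one, h1, h2, h3, h4]
        abel
      · rw [add_zero, h1]
    · change star _ = _
      rw [Matrix.star_eq_conjTranspose, isometryMeasurement]
      split_ifs <;> simp [Matrix.conjTranspose_mul, hs, Matrix.mul_assoc]
  sum_eq_one := by
    simp only [isometryMeasurement, Finset.sum_add_distrib, Finset.sum_ite_eq', Finset.mem_univ,
      if_true, ← Matrix.mul_sum, ← Matrix.sum_mul, hP.sum_eq_one, Matrix.mul_one]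
    abel

/-- Compression by J kills the complement 1 − J Jᴴ, so the default outcome never contributes on the
range of J. Hence local isometries leave winning probabilities unchanged. -/
lemma conjTranspose_mul_isometryMeasurement_mul {Ω : Type*} [DecidableEq Ω] (o : Ω)
    {J : Matrix β α ℂ} (hJ : Jᴴ * J = 1) (P : Ω → Matrix α α ℂ) (a : Ω) :
    Jᴴ * isometryMeasurement o J P a * J = P a := by
  have h1 : Jᴴ * (J * P a * Jᴴ) * J = P a := by
    calc Jᴴ * (J * P a * Jᴴ) * J = (Jᴴ * J) * P a * (Jᴴ * J) := by simp only [Matrix.mul_assoc]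
      _ = _ := by rw [hJ, Matrix.mul_one, Matrix.one_mul]
  rw [isometryMeasurement, Matrix.mul_add, Matrix.add_mul, h1]
  split_ifs
  · rw [Matrix.mul_sub, ← Matrix.mul_assoc, hJ]
    simp
  · simp

end Measurement

end Quantum

namespace EntangledGame

open Quantum

variable {I O : Type*} [Fintype I] [Fintype O]

/-! ### Winning effects and bounds on the winning probability. -/

section WinEffect

variable {α β : Type*} [Fintype α] [Fintype β]

/-- The operator `∑_{a,b} V(a,b|x,y) P_a ⊗ Q_b` of the event that the players win. -/
def winEffect (G : EntangledGame I O) (x y : I) (P : O → Matrix α α ℂ) (Q : O → Matrix β β ℂ) :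
    Matrix (α × β) (α × β) ℂ :=
  ∑ a, ∑ b, (if G.V a b x y then (1 : ℂ) else 0) • (P a ⊗ₖ Q b)

lemma winProb_eq (G : EntangledGame I O) (φ : I → I → α × β → ℂ) (P : I → O → Matrix α α ℂ)
    (Q : I → O → Matrix β β ℂ) : G.winProb φ P Q =
      ∑ x, ∑ y, G.p x y * (star (φ x y) ⬝ᵥ (G.winEffect x y (P x) (Q y) *ᵥ φ x y)).re := by
  refine Finset.sum_congr rfl fun x _ => Finset.sum_congr rfl fun y _ => ?_
  simp only [winEffect, Matrix.sum_mulVec, dotProduct_sum, Complex.re_sum, Finset.mul_sum]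
  refine Finset.sum_congr rfl fun a _ => Finset.sum_congr rfl fun b _ => ?_
  split_ifs <;> simp

variable [DecidableEq α] [DecidableEq β]

lemma posSemidef_winEffect (G : EntangledGame I O) (x y : I) {P : O → Matrix α α ℂ}
    {Q : O → Matrix β β ℂ} (hP : IsProjectiveMeasurement P) (hQ : IsProjectiveMeasurement Q) :
    (G.winEffect x y P Q).PosSemidef := by
  refine Matrix.posSemidef_sum _ fun a _ => Matrix.posSemidef_sum _ fun b _ => ?_
  have := (posSemidef_of_isStarProjection (hP.isStarProjection a)).kronecker
    (posSemidef_of_isStarProjection (hQ.isStarProjection b))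
  split_ifs
  · simpa using this
  · simpa using Matrix.PosSemidef.zero

lemma posSemidef_one_sub_winEffect (G : EntangledGame I O) (x y : I) {P : O → Matrix α α ℂ}
    {Q : O → Matrix β β ℂ} (hP : IsProjectiveMeasurement P) (hQ : IsProjectiveMeasurement Q) :
    (1 - G.winEffect x y P Q).PosSemidef := by
  have h1 : (1 : Matrix (α × β) (α × β) ℂ) = ∑ a, ∑ b, P a ⊗ₖ Q b := by
    rw [← Matrix.one_kronecker_one, ← hP.sum_eq_one, ← hQ.sum_eq_one]
    ext i j
    simp [Matrix.sum_apply, Finset.sum_mul_sum]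
  rw [h1, winEffect, ← Finset.sum_sub_distrib]
  refine Matrix.posSemidef_sum _ fun a _ => ?_
  rw [← Finset.sum_sub_distrib]
  refine Matrix.posSemidef_sum _ fun b _ => ?_
  have := (posSemidef_of_isStarProjection (hP.isStarProjection a)).kronecker
    (posSemidef_of_isStarProjection (hQ.isStarProjection b))
  split_ifs
  · simpa using Matrix.PosSemidef.zero
  · simpa using this

lemma one_sub_re_winEffect_eq (G : EntangledGame I O) (x y : I) (P : O → Matrix α α ℂ)
    (Q : O → Matrix β β ℂ) {φ : α × β → ℂ} (hφ : IsPureState φ) :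
    1 - (star φ ⬝ᵥ (G.winEffect x y P Q *ᵥ φ)).re =
      (star φ ⬝ᵥ ((1 - G.winEffect x y P Q) *ᵥ φ)).re := by
  rw [IsPureState] at hφ
  rw [Matrix.sub_mulVec, Matrix.one_mulVec, dotProduct_sub, hφ, Complex.sub_re, Complex.one_re]

lemma one_sub_winProb_eq (G : EntangledGame I O) {φ : I → I → α × β → ℂ}
    (hφ : ∀ x y, IsPureState (φ x y)) (P : I → O → Matrix α α ℂ) (Q : I → O → Matrix β β ℂ) :
    1 - G.winProb φ P Q = ∑ x, ∑ y, G.p x y *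
      (star (φ x y) ⬝ᵥ ((1 - G.winEffect x y (P x) (Q y)) *ᵥ φ x y)).re := by
  simp only [← G.one_sub_re_winEffect_eq _ _ _ _ (hφ _ _), mul_sub, mul_one,
    Finset.sum_sub_distrib, G.p_sum, winProb_eq]

lemma winProb_le_one (G : EntangledGame I O) {φ : I → I → α × β → ℂ}
    (hφ : ∀ x y, IsPureState (φ x y)) {P : I → O → Matrix α α ℂ} {Q : I → O → Matrix β β ℂ}
    (hP : ∀ x, IsProjectiveMeasurement (P x)) (hQ : ∀ y, IsProjectiveMeasurement (Q y)) :
    G.winProb φ P Q ≤ 1 := by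
  rw [← sub_nonneg, G.one_sub_winProb_eq hφ]
  exact Finset.sum_nonneg fun x _ => Finset.sum_nonneg fun y _ => mul_nonneg (G.p_nonneg x y)
    (Complex.le_def.1 ((G.posSemidef_one_sub_winEffect x y (hP x) (hQ y)).dotProduct_mulVec_nonneg
      (φ x y))).1

lemma winProb_isometry [DecidableEq O] {γ δ : Type*} [Fintype γ] [DecidableEq γ] [Fintype δ]
    [DecidableEq δ] (G : EntangledGame I O) (φ : I → I → α × β → ℂ) (P : I → O → Matrix α α ℂ)
    (Q : I → O → Matrix β β ℂ) (o : O) {J : I → Matrix γ α ℂ} {K : I → Matrix δ β ℂ}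
    (hJ : ∀ x, (J x)ᴴ * J x = 1) (hK : ∀ y, (K y)ᴴ * K y = 1) :
    G.winProb (fun x y => (J x ⊗ₖ K y) *ᵥ φ x y) (fun x => isometryMeasurement o (J x) (P x))
      (fun y => isometryMeasurement o (K y) (Q y)) = G.winProb φ P Q := by
  simp only [winProb, star_mulVec_dotProduct, Matrix.conjTranspose_kronecker,
    ← Matrix.mul_kronecker_mul, conjTranspose_mul_isometryMeasurement_mul o (hJ _),
    conjTranspose_mul_isometryMeasurement_mul o (hK _)]

/-- The supremum ranges over registers `Fin m`, `Fin n`, so a strategy on arbitrary finite index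
types, such as the direct sums built below, is relabelled first. -/
lemma winProb_le_value (G : EntangledGame I O) {φ : α × β → ℂ} (hφ : IsPureState φ)
    {P : I → O → Matrix α α ℂ} {Q : I → O → Matrix β β ℂ}
    (hP : ∀ x, IsProjectiveMeasurement (P x)) (hQ : ∀ y, IsProjectiveMeasurement (Q y)) :
    G.winProb (fun _ _ => φ) P Q ≤ G.value := by
  refine le_csSup ⟨1, ?_⟩ ?_
  · rintro r ⟨m, n, φ, P, Q, hφ, hP, hQ, rfl⟩
    exact G.winProb_le_one (fun _ _ => hφ) hP hQ
  · let e := (Fintype.equivFin α).symm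
    let f := (Fintype.equivFin β).symm
    refine ⟨Fintype.card α, Fintype.card β, φ ∘ Prod.map e f, fun x a => (P x a).submatrix e e,
      fun y b => (Q y b).submatrix f f, ?_, fun x => (hP x).reindex e, fun y => (hQ y).reindex f,
      ?_⟩
    · rw [IsPureState] at hφ ⊢
      rw [← hφ]
      exact (Equiv.prodCongr e f).sum_comp fun i => star φ i * φ i
    · refine Finset.sum_congr rfl fun x _ => Finset.sum_congr rfl fun y _ =>
        Finset.sum_congr rfl fun a _ => Finset.sum_congr rfl fun b _ => ?_
      congr 2
      refine ((Equiv.prodCongr e f).sum_comp fun i =>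
        star φ i * ((P x a ⊗ₖ Q y b) *ᵥ φ) i).symm.trans ?_
      refine Finset.sum_congr rfl fun i _ => ?_
      refine congrArg₂ (· * ·) rfl ?_
      exact ((Equiv.prodCongr e f).sum_comp fun j =>
        (P x a ⊗ₖ Q y b) (Equiv.prodCongr e f i) j * φ j).symm

end WinEffect

end EntangledGame

namespace Quantum

/-! ### Superposed states for uniform inputs, and the decoupling isometries. -/

section UniformAdvice

variable {I α β : Type*} [Fintype I] {p : I → I → ℝ} {w : ℝ}

lemma uniform_marginal (hcard : (Fintype.card I : ℝ) * w = 1) : ∑ _ : I, w ^ 2 = w := by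
  rw [Finset.sum_const, Finset.card_univ, nsmul_eq_mul]
  linear_combination w * hcard

lemma one_div_sqrt_mul_sqrt_sq (hw : 0 < w) : 1 / √w * √(w ^ 2) = √w := by
  rw [Real.sqrt_sq hw.le, div_mul_eq_mul_div, one_mul, Real.div_sqrt]

/-- The amplitudes of `|L^A_y⟩`, as a matrix from `B` to `X A`. -/
def ampA (w : ℝ) (φ : I → I → α × β → ℂ) (y : I) : Matrix (I × α) β ℂ :=
  Matrix.of fun s b => (√w : ℂ) * φ s.1 y (s.2, b)

/-- The amplitudes of `|L^B_x⟩`, as a matrix from `A` to `B Y`. -/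
def ampB (w : ℝ) (φ : I → I → α × β → ℂ) (x : I) : Matrix (β × I) α ℂ :=
  Matrix.of fun s a => (√w : ℂ) * φ x s.2 (a, s.1)

lemma sigmaAReduced_apply [DecidableEq I] [Fintype β] (hw : 0 < w) (hcard : (Fintype.card I : ℝ) * w = 1)
    (hp : ∀ x y, p x y = w ^ 2) (φ : I → I → α × β → ℂ) (y : I) (s : I × α) (y' : I)
    (s' : I × α) : sigmaAReduced p φ (y, s) (y', s') =
      if y = y' then (w : ℂ) * (ampA w φ y * (ampA w φ y)ᴴ) s s' else 0 := by
  simp only [sigmaAReduced, traceRight, Matrix.of_apply, Matrix.submatrix_apply, sigmaA,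
    Matrix.sum_apply, Matrix.smul_apply, Matrix.kronecker_apply, ketbra, Matrix.vecMulVec_apply,
    ketLA, hp, uniform_marginal hcard, one_div_sqrt_mul_sqrt_sq hw, Pi.star_apply,
    Matrix.mul_apply, Matrix.conjTranspose_apply, ampA, Pi.single_apply]
  split_ifs with hy
  · subst hy
    rw [Finset.mul_sum]
    refine Finset.sum_congr rfl fun b _ => ?_
    rw [Finset.sum_eq_single y (fun z _ hz => by simp [Ne.symm hz]) (by simp)]
    simp
  · refine Finset.sum_eq_zero fun b _ => Finset.sum_eq_zero fun z _ => ?_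
    by_cases hz : y = z
    · have : y' ≠ z := fun h => hy (hz.trans h.symm)
      simp [this]
    · simp [hz]

lemma sigmaBReduced_apply [DecidableEq I] [Fintype α] (hw : 0 < w) (hcard : (Fintype.card I : ℝ) * w = 1)
    (hp : ∀ x y, p x y = w ^ 2) (φ : I → I → α × β → ℂ) (x : I) (s : β × I) (x' : I)
    (s' : β × I) : sigmaBReduced p φ (x, s) (x', s') =
      if x = x' then (w : ℂ) * (ampB w φ x * (ampB w φ x)ᴴ) s s' else 0 := by
  simp only [sigmaBReduced, traceRight, Matrix.of_apply, Matrix.submatrix_apply, sigmaB,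
    Matrix.sum_apply, Matrix.smul_apply, Matrix.kronecker_apply, ketbra, Matrix.vecMulVec_apply,
    ketLB, hp, uniform_marginal hcard, one_div_sqrt_mul_sqrt_sq hw, Pi.star_apply,
    Matrix.mul_apply, Matrix.conjTranspose_apply, ampB, Pi.single_apply]
  split_ifs with hx
  · subst hx
    rw [Finset.mul_sum]
    refine Finset.sum_congr rfl fun b _ => ?_
    rw [Finset.sum_eq_single x (fun z _ hz => by simp [Ne.symm hz]) (by simp)]
    simp
  · refine Finset.sum_eq_zero fun b _ => Finset.sum_eq_zero fun z _ => ?_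
    by_cases hz : x = z
    · have : x' ≠ z := fun h => hx (hz.trans h.symm)
      simp [this]
    · simp [hz]

lemma norm_sq_ofReal_sqrt (hw : 0 < w) : ‖(√w : ℂ)‖ ^ 2 = w := by
  rw [Complex.norm_real, Real.norm_eq_abs, sq_abs, Real.sq_sqrt hw.le]

/-- The register `X` indexes blocks of rows and `W` acts on columns only, so the superposition over
x turns into an average over x of distances between individual advice states. -/
lemma hsNormSq_ampA_mul_sub {γ : Type*} [Fintype γ] [Fintype α] [Fintype β] (hw : 0 < w) (φ : I → I → α × β → ℂ)
    (W : I → Matrix β γ ℂ) (y y' : I) :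
    hsNormSq (ampA w φ y * W y - ampA w φ y' * W y') =
      w * ∑ x, hsNormSq (coeffMatrix (φ x y) * W y - coeffMatrix (φ x y') * W y') := by
  simp only [hsNormSq, Fintype.sum_prod_type, Finset.mul_sum, Matrix.sub_apply, Matrix.mul_apply,
    ampA, coeffMatrix, Matrix.of_apply]
  refine Finset.sum_congr rfl fun x _ => Finset.sum_congr rfl fun a _ =>
    Finset.sum_congr rfl fun c _ => ?_
  simp only [mul_assoc]
  rw [← Finset.mul_sum, ← Finset.mul_sum, ← mul_sub, norm_mul, mul_pow, norm_sq_ofReal_sqrt hw]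

lemma hsNormSq_ampB_mul_sub {γ : Type*} [Fintype γ] [Fintype α] [Fintype β] (hw : 0 < w) (φ : I → I → α × β → ℂ)
    (V : I → Matrix α γ ℂ) (x x' : I) :
    hsNormSq (ampB w φ x * V x - ampB w φ x' * V x') =
      w * ∑ y, hsNormSq ((V x)ᵀ * coeffMatrix (φ x y) - (V x')ᵀ * coeffMatrix (φ x' y)) := by
  have : ∀ y, hsNormSq ((V x)ᵀ * coeffMatrix (φ x y) - (V x')ᵀ * coeffMatrix (φ x' y)) =
      hsNormSq ((coeffMatrix (φ x y))ᵀ * V x - (coeffMatrix (φ x' y))ᵀ * V x') := fun y => by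
    rw [← hsNormSq_transpose, Matrix.transpose_sub, Matrix.transpose_mul, Matrix.transpose_mul,
      Matrix.transpose_transpose, Matrix.transpose_transpose]
  simp only [this]
  simp only [hsNormSq, Fintype.sum_prod_type_right, Finset.mul_sum, Matrix.sub_apply,
    Matrix.mul_apply, ampB, coeffMatrix, Matrix.of_apply, Matrix.transpose_apply]
  refine Finset.sum_congr rfl fun x _ => Finset.sum_congr rfl fun a _ =>
    Finset.sum_congr rfl fun c _ => ?_
  simp only [mul_assoc]
  rw [← Finset.mul_sum, ← Finset.mul_sum, ← mul_sub, norm_mul, mul_pow, norm_sq_ofReal_sqrt hw]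

lemma trace_mul_conjTranspose_eq {m n : Type*} [Fintype m] [Fintype n] (A : Matrix m n ℂ) :
    (A * Aᴴ).trace = (hsNormSq A : ℂ) := by
  rw [ofReal_hsNormSq, Matrix.trace_mul_comm]

lemma trace_ampA [Fintype α] [Fintype β] (hw : 0 < w) (hcard : (Fintype.card I : ℝ) * w = 1) {φ : I → I → α × β → ℂ}
    (hφ : ∀ x y, IsPureState (φ x y)) (y : I) : (ampA w φ y * (ampA w φ y)ᴴ).trace = 1 := by
  have : hsNormSq (ampA w φ y) = w * ∑ x, hsNormSq (coeffMatrix (φ x y)) := by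
    simp only [hsNormSq, Fintype.sum_prod_type, Finset.mul_sum, ampA, coeffMatrix, Matrix.of_apply,
      norm_mul, mul_pow, norm_sq_ofReal_sqrt hw]
  rw [trace_mul_conjTranspose_eq, this]
  simp only [(hφ _ _).hsNormSq_coeffMatrix, Finset.sum_const, Finset.card_univ, nsmul_one,
    mul_comm w, hcard, Complex.ofReal_one]

lemma trace_ampB [Fintype α] [Fintype β] (hw : 0 < w) (hcard : (Fintype.card I : ℝ) * w = 1) {φ : I → I → α × β → ℂ}
    (hφ : ∀ x y, IsPureState (φ x y)) (x : I) : (ampB w φ x * (ampB w φ x)ᴴ).trace = 1 := by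
  have : hsNormSq (ampB w φ x) = w * ∑ y, hsNormSq (coeffMatrix (φ x y)) := by
    simp only [← hsNormSq_transpose (coeffMatrix _)]
    simp only [hsNormSq, Fintype.sum_prod_type_right, Finset.mul_sum, ampB, coeffMatrix,
      Matrix.of_apply, Matrix.transpose_apply, norm_mul, mul_pow, norm_sq_ofReal_sqrt hw]
  rw [trace_mul_conjTranspose_eq, this]
  simp only [(hφ _ _).hsNormSq_coeffMatrix, Finset.sum_const, Finset.card_univ, nsmul_one,
    mul_comm w, hcard, Complex.ofReal_one]

lemma transpose_isometry {m n : Type*} [Fintype n] [DecidableEq m]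
    {W : Matrix m n ℂ} (hW : W * Wᴴ = 1) : Wᵀᴴ * Wᵀ = 1 := by
  have := congrArg Matrix.transpose hW
  rwa [Matrix.transpose_mul, Matrix.transpose_one] at this

lemma sq_mul_sum_mul_sum (w : ℝ) (a : I → I → I → ℝ) :
    w ^ 2 * ∑ y, ∑ z, (w * ∑ x, a x y z) = w ^ 3 * ∑ x, ∑ y, ∑ z, a x y z := by
  simp only [← Finset.mul_sum]
  rw [← mul_assoc, ← pow_succ]
  congr 1
  exact (Finset.sum_congr rfl fun y _ => Finset.sum_comm).trans Finset.sum_comm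

/-- Local isometries make a family of advice states nearly independent of the inputs, up to its
superposed information cost. -/
lemma exists_isometries_of_superposedInfoCost [DecidableEq I] [Fintype α] [DecidableEq α]
    [Fintype β] [DecidableEq β] (hw : 0 < w)
    (hcard : (Fintype.card I : ℝ) * w = 1) (hp : ∀ x y, p x y = w ^ 2) {φ : I → I → α × β → ℂ}
    (hφ : ∀ x y, IsPureState (φ x y)) :
    ∃ (J : I → Matrix (α ⊕ (β × I)) α ℂ) (K : I → Matrix (β ⊕ (I × α)) β ℂ),
      (∀ x, (J x)ᴴ * J x = 1) ∧ (∀ y, (K y)ᴴ * K y = 1) ∧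
      w ^ 3 * (∑ x, ∑ y, ∑ y', ∑ i, ‖((J x ⊗ₖ K y) *ᵥ φ x y - (J x ⊗ₖ K y') *ᵥ φ x y') i‖ ^ 2) +
      w ^ 3 * (∑ y, ∑ x, ∑ x', ∑ i, ‖((J x ⊗ₖ K y) *ᵥ φ x y - (J x' ⊗ₖ K y) *ᵥ φ x' y) i‖ ^ 2) ≤
        4 * (Real.log 2 * superposedInfoCost p φ) := by
  obtain ⟨W, hW, hA⟩ := exists_coisometry_of_mutualInfo (trace_ampA hw hcard hφ) hw hcard
    (isHermitian_sigmaAReduced p φ) (sigmaAReduced_apply hw hcard hp φ)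
  obtain ⟨V, hV, hB⟩ := exists_coisometry_of_mutualInfo (trace_ampB hw hcard hφ) hw hcard
    (isHermitian_sigmaBReduced p φ) (sigmaBReduced_apply hw hcard hp φ)
  have hK := fun y => transpose_isometry (hW y)
  have hJ := fun x => transpose_isometry (hV x)
  -- Right multiplication of an amplitude matrix by W acts on the column register as Wᵀ, which turns
  -- co-isometries into isometries.
  refine ⟨fun x => (V x)ᵀ, fun y => (W y)ᵀ, hJ, hK, ?_⟩
  simp only [hsNormSq_ampA_mul_sub hw] at hA
  simp only [hsNormSq_ampB_mul_sub hw] at hB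
  -- Both vectors carry the same isometry on `A`, which drops out of the norm; so the estimate for
  -- `W`, obtained independently of `V`, survives. `eB` is the mirror image.
  have eA : ∀ x y y', ∑ i, ‖(((V x)ᵀ ⊗ₖ (W y)ᵀ) *ᵥ φ x y - ((V x)ᵀ ⊗ₖ (W y')ᵀ) *ᵥ φ x y') i‖ ^ 2 =
      hsNormSq (coeffMatrix (φ x y) * W y - coeffMatrix (φ x y') * W y') := fun x y y' => by
    rw [← hsNormSq_coeffMatrix_sub, coeffMatrix_kronecker_mulVec, coeffMatrix_kronecker_mulVec,
      Matrix.transpose_transpose, Matrix.transpose_transpose, Matrix.mul_assoc, Matrix.mul_assoc,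
      ← Matrix.mul_sub, hsNormSq_isometry_mul (hJ x)]
  have eB : ∀ y x x', ∑ i, ‖(((V x)ᵀ ⊗ₖ (W y)ᵀ) *ᵥ φ x y - ((V x')ᵀ ⊗ₖ (W y)ᵀ) *ᵥ φ x' y) i‖ ^ 2 =
      hsNormSq ((V x)ᵀ * coeffMatrix (φ x y) - (V x')ᵀ * coeffMatrix (φ x' y)) := fun y x x' => by
    rw [← hsNormSq_coeffMatrix_sub, coeffMatrix_kronecker_mulVec, coeffMatrix_kronecker_mulVec,
      Matrix.transpose_transpose, ← Matrix.sub_mul, hsNormSq_mul_coisometry (hW y)]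
  simp only [eA, eB]
  rw [superposedInfoCost, mul_add, mul_add]
  rw [sq_mul_sum_mul_sum w fun x y y' =>
    hsNormSq (coeffMatrix (φ x y) * W y - coeffMatrix (φ x y') * W y')] at hA
  rw [sq_mul_sum_mul_sum w fun y x x' =>
    hsNormSq ((V x)ᵀ * coeffMatrix (φ x y) - (V x')ᵀ * coeffMatrix (φ x' y))] at hB
  exact add_le_add hA hB

end UniformAdvice

end Quantum

/-! ### Replacing the advice by a single shared state. -/

namespace EntangledGame

open Quantum

variable {I O : Type*} [Fintype I] [Fintype O]

lemma sum_norm_sq_sub_le {ι : Type*} [Fintype ι] (u v w : ι → ℂ) :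
    ∑ i, ‖(u - w) i‖ ^ 2 ≤ 2 * ∑ i, ‖(u - v) i‖ ^ 2 + 2 * ∑ i, ‖(v - w) i‖ ^ 2 := by
  simp only [Finset.mul_sum, ← Finset.sum_add_distrib]
  refine Finset.sum_le_sum fun i _ => ?_
  have h : ‖(u - w) i‖ ≤ ‖(u - v) i‖ + ‖(v - w) i‖ := by
    simpa using norm_sub_le_norm_sub_add_norm_sub (u i) (v i) (w i)
  nlinarith [norm_nonneg ((u - w) i), sq_nonneg (‖(u - v) i‖ - ‖(v - w) i‖)]

/-- Average the hypothesis over x₀ and y₀. Each of `a` and `b` ignores one of the four summation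
indices, so the weight w⁴ becomes w³. -/
lemma le_of_forall_le_add_sum {w : ℝ} (hcard : (Fintype.card I : ℝ) * w = 1) {v t : ℝ}
    {a b : I → I → I → ℝ}
    (h : ∀ x₀ y₀, v ≤ t + w ^ 2 * ∑ x, ∑ y, (4 * a x y y₀ + 4 * b y₀ x x₀)) :
    v ≤ t + 4 * (w ^ 3 * (∑ x, ∑ y, ∑ y', a x y y') + w ^ 3 * (∑ y, ∑ x, ∑ x', b y x x')) := by
  have hsum := mul_le_mul_of_nonneg_left (Finset.sum_le_sum fun x₀ (_ : x₀ ∈ Finset.univ) =>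
    Finset.sum_le_sum fun y₀ (_ : y₀ ∈ Finset.univ) => h x₀ y₀) (sq_nonneg w)
  have hA : ∑ y₀, ∑ x, ∑ y, a x y y₀ = ∑ x, ∑ y, ∑ y', a x y y' :=
    Finset.sum_comm.trans (Finset.sum_congr rfl fun x _ => Finset.sum_comm)
  have hB : ∑ x₀, ∑ y₀, ∑ x, b y₀ x x₀ = ∑ y, ∑ x, ∑ x', b y x x' :=
    Finset.sum_comm.trans (Finset.sum_congr rfl fun x _ => Finset.sum_comm)
  simp only [Finset.sum_add_distrib, ← Finset.mul_sum, Finset.sum_const, Finset.card_univ,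
    nsmul_eq_mul, hA, hB] at hsum
  generalize ∑ x, ∑ y, ∑ y', a x y y' = A at hsum ⊢
  generalize ∑ y, ∑ x, ∑ x', b y x x' = B at hsum ⊢
  set N : ℝ := (Fintype.card I : ℝ)
  have e1 : w ^ 2 * (N * (N * v)) = v := by linear_combination v * (N * w + 1) * hcard
  have e2 : w ^ 2 * (N * (N * t)) = t := by linear_combination t * (N * w + 1) * hcard
  have e3 : w ^ 2 * (w ^ 2 * (4 * (N * A) + 4 * (N * B))) = 4 * (w ^ 3 * A + w ^ 3 * B) := by
    linear_combination 4 * w ^ 3 * (A + B) * hcard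
  rw [mul_add, e1, e2, e3] at hsum
  exact hsum

/-- Sharing the fixed state `θ x₀ y₀` instead of `θ x y` costs at most the average squared
distance. -/
lemma one_sub_value_le {α β : Type*} [Fintype α] [DecidableEq α] [Fintype β] [DecidableEq β]
    (G : EntangledGame I O) {w : ℝ} (hcard : (Fintype.card I : ℝ) * w = 1)
    (hp : ∀ x y, G.p x y = w ^ 2) {θ : I → I → α × β → ℂ} (hθ : ∀ x y, IsPureState (θ x y))
    {P : I → O → Matrix α α ℂ} {Q : I → O → Matrix β β ℂ}
    (hP : ∀ x, IsProjectiveMeasurement (P x)) (hQ : ∀ y, IsProjectiveMeasurement (Q y)) :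
    1 - G.value ≤ 2 * (1 - G.winProb θ P Q) +
      4 * (w ^ 3 * (∑ x, ∑ y, ∑ y', ∑ i, ‖(θ x y - θ x y') i‖ ^ 2) +
        w ^ 3 * (∑ y, ∑ x, ∑ x', ∑ i, ‖(θ x y - θ x' y) i‖ ^ 2)) := by
  refine le_of_forall_le_add_sum hcard (a := fun x y y' => ∑ i, ‖(θ x y - θ x y') i‖ ^ 2)
    (b := fun y x x' => ∑ i, ‖(θ x y - θ x' y) i‖ ^ 2) fun x₀ y₀ => ?_
  have h1 := G.winProb_le_value (hθ x₀ y₀) hP hQ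
  -- The losing effect is compared on θ_{x₀y₀} and θ_xy, and their distance is split at θ_{xy₀},
  -- changing one input at a time. The 4 is a 2 from the effect bound times a 2 from the split.
  have h2 : 1 - G.winProb (fun _ _ => θ x₀ y₀) P Q ≤ 2 * (1 - G.winProb θ P Q) +
    w ^ 2 * ∑ x, ∑ y, (4 * ∑ i, ‖(θ x y - θ x y₀) i‖ ^ 2 +
      4 * ∑ i, ‖(θ x y₀ - θ x₀ y₀) i‖ ^ 2) := by
    rw [G.one_sub_winProb_eq (fun _ _ => hθ x₀ y₀), G.one_sub_winProb_eq hθ]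
    simp only [Finset.mul_sum, ← Finset.sum_add_distrib, hp]
    refine Finset.sum_le_sum fun x _ => Finset.sum_le_sum fun y _ => ?_
    simp only [← Finset.mul_sum, Finset.sum_add_distrib]
    have h3 := re_dotProduct_mulVec_le (G.posSemidef_one_sub_winEffect x y (hP x) (hQ y))
      (by simpa using G.posSemidef_winEffect x y (hP x) (hQ y)) (θ x₀ y₀) (θ x y)
    have h4 := sum_norm_sq_sub_le (θ x y) (θ x y₀) (θ x₀ y₀)
    have h5 : ∑ i, ‖(θ x₀ y₀ - θ x y) i‖ ^ 2 = ∑ i, ‖(θ x y - θ x₀ y₀) i‖ ^ 2 :=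
      Finset.sum_congr rfl fun i _ => by rw [Pi.sub_apply, Pi.sub_apply, norm_sub_rev]
    rw [h5] at h3
    have := mul_le_mul_of_nonneg_left (h3.trans (add_le_add_right
      (mul_le_mul_of_nonneg_left h4 zero_le_two) _)) (sq_nonneg w)
    linarith
  linarith

lemma one_sub_value_le_mul_superposedInfoCost [DecidableEq I] {α β : Type*} [Fintype α] [DecidableEq α]
    [Fintype β] [DecidableEq β] (G : EntangledGame I O) (hG : G.IsUniform)
    {φ : I → I → α × β → ℂ} (hφ : ∀ x y, IsPureState (φ x y)) (h1 : G.valueGiven φ = 1) :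
    1 - G.value ≤ 32 * Real.log 2 * superposedInfoCost G.p φ := by
  classical
  have hI : Nonempty I := by
    by_contra h
    rw [not_nonempty_iff] at h
    simpa using G.p_sum
  have hn : (0 : ℝ) < Fintype.card I := by exact_mod_cast Fintype.card_pos
  set w : ℝ := 1 / Fintype.card I with hwdef
  have hw : 0 < w := by positivity
  have hcard : (Fintype.card I : ℝ) * w = 1 := by rw [hwdef]; field_simp
  have hp : ∀ x y, G.p x y = w ^ 2 := fun x y => by rw [hG x y, hwdef, div_pow, one_pow]
  obtain ⟨J, K, hJ, hK, hJK⟩ := exists_isometries_of_superposedInfoCost hw hcard hp hφ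
  -- The argument yields the factor 4 · 4 = 16; nonnegativity of the cost, read off from `hJK`,
  -- permits weakening it to 32.
  have hcost : 0 ≤ Real.log 2 * superposedInfoCost G.p φ := by
    have : 0 ≤ 4 * (Real.log 2 * superposedInfoCost G.p φ) := le_trans (by positivity) hJK
    linarith
  -- Working up to ε avoids showing that the supremum in `valueGiven` is attained; a loss below ε/2
  -- enters doubled.
  refine le_of_forall_pos_le_add fun ε hε => ?_
  have hne : {r | ∃ (P : I → O → Matrix α α ℂ) (Q : I → O → Matrix β β ℂ),
      (∀ x, IsProjectiveMeasurement (P x)) ∧ (∀ y, IsProjectiveMeasurement (Q y)) ∧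
      r = G.winProb φ P Q}.Nonempty := by
    by_contra h
    rw [valueGiven, Set.not_nonempty_iff_eq_empty.1 h, Real.sSup_empty] at h1
    exact zero_ne_one h1
  obtain ⟨_, ⟨P, Q, hP, hQ, rfl⟩, hwin⟩ :=
    exists_lt_of_lt_csSup hne (show 1 - ε / 2 < _ from (by linarith : 1 - ε / 2 < 1).trans_eq h1.symm)
  obtain ⟨x⟩ := hI
  -- The transported measurements need a default outcome. One exists because an empty family of
  -- projections cannot sum to the identity on a nonzero space.
  have hO : Nonempty O := by
    by_contra h
    rw [not_nonempty_iff] at h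
    obtain ⟨a, _⟩ := (hφ x x).nonempty
    have := congrFun (congrFun (hP x).sum_eq_one a) a
    simp at this
  obtain ⟨o⟩ := hO
  have hJKiso : ∀ x y, (J x ⊗ₖ K y)ᴴ * (J x ⊗ₖ K y) = 1 := fun x y => by
    rw [Matrix.conjTranspose_kronecker, ← Matrix.mul_kronecker_mul, hJ, hK,
      Matrix.one_kronecker_one]
  have := G.one_sub_value_le hcard hp (fun x y => (hφ x y).isometry_mulVec (hJKiso x y))
    (fun x => (hP x).isometry o (hJ x)) (fun y => (hQ y).isometry o (hK y))
  rw [G.winProb_isometry φ P Q o hJ hK] at this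
  linarith

end EntangledGame

end

theorem theorem2 {I O : Type*} [Fintype I] [DecidableEq I] [Fintype O]
    (G : EntangledGame I O) (hG : G.IsUniform) :
    (((1 - G.value) / (32 * Real.log 2) : ℝ) : EReal) ≤ G.SIC ∧
      (1 : EReal) - ((32 * Real.log 2 : ℝ) : EReal) * G.SIC ≤ (G.value : EReal) := by
  have hc : 0 < 32 * Real.log 2 := mul_pos (by norm_num) (Real.log_pos one_lt_two)
  have h : (((1 - G.value) / (32 * Real.log 2) : ℝ) : EReal) ≤ G.SIC := by
    refine le_sInf ?_
    rintro _ ⟨m, n, φ, hφ, h1, rfl⟩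
    rw [EReal.coe_le_coe_iff, div_le_iff₀' hc]
    exact G.one_sub_value_le_mul_superposedInfoCost hG hφ h1
  refine ⟨h, ?_⟩
  -- The first bound excludes `⊥`; at `⊤` the left side is `⊥`, and only a finite cost needs
  -- arithmetic.
  induction hS : G.SIC with
  | bot => rw [hS] at h; exact absurd (le_bot_iff.1 h) (EReal.coe_ne_bot _)
  | top =>
    rw [EReal.coe_mul_top_of_pos hc]
    simp
  | coe s =>
    rw [hS, EReal.coe_le_coe_iff, div_le_iff₀' hc] at h
    norm_cast
    linarith
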